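/- Let $(K,\partial)$ be a differential field of characteristic $0$ whose field of constants $C$ is algebraically closed. In the ring of differential polynomials $C\{u\}=C[u,u',u'',\dots]$ let $\partial^{-1}g$ denote the antiderivative of $g$ without constant term. Define $$\mathrm{kdv}_0=u',\quad \mathrm{kdv}_{n+1}=\bigl(-\tfrac14\partial^2+u+\tfrac12u'\partial^{-1}\bigr)\mathrm{kdv}_n,\qquad v_0=1,\quad v_{n+1}=\bigl(-\tfrac14\partial^2+u-\tfrac12\partial^{-1}u'\bigr)v_n$$ (all of these are differential polynomials). In $C\{u\}[\partial]$, with $L=-\partial^2+u$, define $P_1=\partial$ and $P_{2n+1}=v_n\partial-\tfrac12\partial(v_n)+P_{2n-1}L$ for $n\ge1$. For $c=(c_1,\dots,c_n)\in C^n$ put $$\mathbf{KdV}_n(u,c)=\mathrm{kdv}_n+\sum_{l=0}^{n-1}c_{n-l}\,\mathrm{kdv}_l,\qquad \hat P_{2n+1}(u,c)=P_{2n+1}+\sum_{l=0}^{n-1}c_{n-l}P_{2l+1}.$$ Let $u_s\in K$ be a non-constant KdV potential of KdV level $s$: $\partial(u_s)\ne0$, and $s$ is the smallest integer $n\ge1$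 for which there is $c\in C^n$ with $\mathbf{KdV}_n(u_s,c)=0$. Let $\bar c^s\in C^s$ be its basic constants vector, that is, $\mathbf{KdV}_s(u_s,\bar c^s)=0$. Put $L_s=-\partial^2+u_s$ and $A_{2s+1}=\hat P_{2s+1}(u_s,\bar c^s)$ in $K[\partial]$. Let $\lambda,\mu$ be indeterminates with $\partial\lambda=\partial\mu=0$. For operators $P,Q$ of orders $n,m$ and $0\le k\le\min\{n,m\}-1$ let $S_k(P,Q)$ be the coefficient matrix of the operators $\partial^{m-1-k}P,\dots,\partial P,P,\partial^{n-1-k}Q,\dots,\partial Q,Q$ (rows in this order; columns indexed by $\partial^{n+m-k-1},\dots,\partial,1$). Let $f_s(\lambda,\mu)=\det S_0(L_s-\lambda,A_{2s+1}-\mu)$ be the differential resultant, and let $$\Gamma_s=\{(\lambda_0,\mu_0)\in C^2: f_s(\lambda_0,\mu_0)=0\}$$ be the spectral curve of $L_s$. Let $\mathcal L_1=\varphi_1+\varphi_2\partial$ be the first differential subresultant of $L_s-\lambda$ and $A_{2s+1}-\mu$: $\varphi_1$ and $\varphi_2$ are the determinants of the square matrices obtained from $S_1(L_s-\lambda,A_{2s+1}-\mu)$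 by deleting the column indexed by $\partial$, respectively by $1$. **Proposition.** There are $\alpha,\varphi_2\in K[\lambda]$ such that the first subresultant has the coefficients $\varphi_1=-\mu-\alpha(\lambda)$ and $\varphi_2=\varphi_2(\lambda)$. For every point $P_0=(\lambda_0,\mu_0)$ of $\Gamma_s$ one has $\varphi_2(\lambda_0)\neq0$, and with $$\phi_0=-\frac{\varphi_1(P_0)}{\varphi_2(P_0)}=\frac{\mu_0+\alpha(\lambda_0)}{\varphi_2(\lambda_0)}\in K$$ the first-order operator $\partial-\phi_0$ is a common right factor of $L_s-\lambda_0$ and $A_{2s+1}-\mu_0$ in $K[\partial]$, and moreover $$L_s-\lambda_0=(-\partial-\phi_0)(\partial-\phi_0).$$ -/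

import Mathlib

open Polynomial

noncomputable section

namespace KdV

/-! ## Constants, and extension of a derivation to polynomials -/

/-- Derivations (additive, with the Leibniz rule) of a commutative ring `E` into itself. -/
abbrev Deriv (E : Type*) [CommRing E] : Type _ := Derivation ℤ E E

/-- The field of constants of a differential field `(K, d)`. -/
def constants {K : Type*} [Field K] (d : Deriv K) : Subfield K where
  carrier := {x | d x = 0}
  mul_mem' := by
    intro a b ha hb
    simp only [Set.mem_ofPred_eq] at ha hb ⊢
    simp [ha, hb]
  one_mem' := by simp
  add_mem' := by
    intro a b ha hb
    simp only [Set.mem_ofPred_eq] at ha hb ⊢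
    simp [ha, hb]
  zero_mem' := by simp
  neg_mem' := by
    intro a ha
    simp only [Set.mem_ofPred_eq] at ha ⊢
    simp [ha]
  inv_mem' := by
    intro a ha
    simp only [Set.mem_ofPred_eq] at ha ⊢
    simp [Derivation.leibniz_inv, ha]

/-- The derivation of `E[X]` that applies `d` to the coefficients, so that `X` is a constant. -/
def polyDeriv {E : Type*} [CommRing E] (d : Deriv E) : Deriv E[X] :=
  LinearMap.compDer
    ((PolynomialModule.equivPolynomialSelf (R := E)).toLinearMap) d.mapCoeffs

theorem coeff_polyDeriv {E : Type*} [CommRing E] (d : Deriv E) (p : E[X]) (i : ℕ) :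
    (polyDeriv d p).coeff i = d (p.coeff i) := rfl

/-! ## The ring of differential operators `E[∂]`

An operator `∑ aᵢ ∂ⁱ` is stored as the polynomial `∑ aᵢ Xⁱ`.  Left multiplication by `∂` sends
`Q` to `Q' + Q ∂` (where `Q'` has the differentiated coefficients), and the product `P Q` is
determined from this by left `E`-linearity.  The facts below show that this is a
ring, that `∂ a = a ∂ + d a`, and that the powers of `∂` are a left basis. -/

/-- Differential operators with coefficients in the differential ring `(E, d)`. -/
def DiffOp {E : Type*} [CommRing E] (_d : Deriv E) : Type _ := E[X]

namespace DiffOp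

variable {E : Type*} [CommRing E] (d : Deriv E)

instance : AddCommGroup (DiffOp d) := inferInstanceAs (AddCommGroup E[X])

/-- The polynomial `∑ aᵢ Xⁱ` attached to `∑ aᵢ ∂ⁱ`. -/
def symbol : DiffOp d ≃+ E[X] := AddEquiv.refl _

/-- Left multiplication by `∂`, on symbols. -/
def mulD : Module.End ℤ E[X] := (polyDeriv d).toLinearMap + LinearMap.mulLeft ℤ X

/-- Left multiplication by elements of `E`, on symbols. -/
def mulC : E →+* Module.End ℤ E[X] := (Algebra.lmul ℤ E[X]).toRingHom.comp C

/-- Left multiplication by the operator `∑ aᵢ ∂ⁱ`, on symbols. -/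
def act (p : E[X]) : Module.End ℤ E[X] := p.eval₂ mulC (mulD d)

theorem mulD_apply (q : E[X]) : mulD d q = polyDeriv d q + X * q := rfl

theorem mulC_apply (a : E) (q : E[X]) : mulC a q = C a * q := rfl

theorem act_add (p q : E[X]) : act d (p + q) = act d p + act d q := eval₂_add _ _

theorem act_monomial (n : ℕ) (a : E) : act d (monomial n a) = mulC a * mulD d ^ n :=
  eval₂_monomial _ _

theorem polyDeriv_C_mul (a : E) (q : E[X]) :
    polyDeriv d (C a * q) = C (d a) * q + C a * polyDeriv d q := by
  ext i
  rw [coeff_polyDeriv, coeff_C_mul, Derivation.leibniz, coeff_add, coeff_C_mul, coeff_C_mul,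
    coeff_polyDeriv, smul_eq_mul, smul_eq_mul]
  ring

theorem polyDeriv_X_mul (q : E[X]) : polyDeriv d (X * q) = X * polyDeriv d q := by
  ext i
  cases i with
  | zero => rw [coeff_polyDeriv, coeff_X_mul_zero, coeff_X_mul_zero, map_zero]
  | succ i => rw [coeff_polyDeriv, coeff_X_mul, coeff_X_mul, coeff_polyDeriv]

theorem mulD_mulC (a : E) : mulD d * mulC a = mulC (d a) + mulC a * mulD d := by
  ext1 q
  simp only [Module.End.mul_apply, LinearMap.add_apply, mulD_apply, mulC_apply, polyDeriv_C_mul]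
  ring

theorem act_C_mul (a : E) (q : E[X]) : act d (C a * q) = mulC a * act d q := by
  induction q using Polynomial.induction_on' with
  | add p q hp hq => rw [mul_add, act_add, act_add, hp, hq, mul_add]
  | monomial n b => rw [C_mul_monomial, act_monomial, act_monomial, map_mul, mul_assoc]

theorem act_mulD (q : E[X]) : act d (mulD d q) = mulD d * act d q := by
  induction q using Polynomial.induction_on' with
  | add p q hp hq => rw [map_add, act_add, act_add, hp, hq, mul_add]
  | monomial n b =>
    have h : polyDeriv d (monomial n b) = monomial n (d b) := by
      ext i
      rw [coeff_polyDeriv, coeff_monomial, coeff_monomial]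
      split_ifs <;> simp
    rw [mulD_apply, h, X_mul_monomial, act_add, act_monomial, act_monomial, act_monomial,
      ← mul_assoc, mulD_mulC, add_mul, pow_succ', mul_assoc]

theorem act_act (p q : E[X]) : act d (act d p q) = act d p * act d q := by
  induction p using Polynomial.induction_on' with
  | add p₁ p₂ h₁ h₂ => rw [act_add, LinearMap.add_apply, act_add, h₁, h₂, add_mul]
  | monomial n a =>
    rw [act_monomial, Module.End.mul_apply, mulC_apply, act_C_mul, mul_assoc]
    congr 1
    induction n with
    | zero => simp
    | succ n ih => rw [pow_succ', Module.End.mul_apply, act_mulD, ih, mul_assoc]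

theorem mulD_pow_one (n : ℕ) : (mulD d ^ n) 1 = X ^ n := by
  induction n with
  | zero => simp
  | succ n ih =>
    have h : polyDeriv d (X ^ n) = 0 := by
      ext i
      rw [coeff_polyDeriv, coeff_X_pow]
      split_ifs <;> simp
    rw [pow_succ', Module.End.mul_apply, ih, mulD_apply, h, zero_add, pow_succ']

theorem act_apply_one (p : E[X]) : act d p 1 = p := by
  induction p using Polynomial.induction_on' with
  | add p q hp hq => rw [act_add, LinearMap.add_apply, hp, hq]
  | monomial n a =>
    rw [act_monomial, Module.End.mul_apply, mulD_pow_one, mulC_apply, C_mul_X_pow_eq_monomial]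

theorem act_one : act d 1 = 1 := by
  rw [act, eval₂_one]

instance : Mul (DiffOp d) := ⟨fun P Q => (symbol d).symm (act d (symbol d P) (symbol d Q))⟩

instance : One (DiffOp d) := ⟨(symbol d).symm 1⟩

theorem symbol_mul (P Q : DiffOp d) :
    symbol d (P * Q) = act d (symbol d P) (symbol d Q) := rfl

theorem symbol_one : symbol d 1 = 1 := rfl

instance : Ring (DiffOp d) :=
  { (inferInstance : AddCommGroup (DiffOp d)) with
    mul := (· * ·)
    one := 1
    left_distrib := fun P Q R => by
      apply (symbol d).injective
      simp only [symbol_mul, map_add]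
    right_distrib := fun P Q R => by
      apply (symbol d).injective
      simp only [symbol_mul, map_add, act_add, LinearMap.add_apply]
    zero_mul := fun P => by
      apply (symbol d).injective
      simp [symbol_mul, act]
    mul_zero := fun P => by
      apply (symbol d).injective
      simp only [symbol_mul, map_zero]
    mul_assoc := fun P Q R => by
      apply (symbol d).injective
      simp only [symbol_mul, act_act, Module.End.mul_apply]
    one_mul := fun P => by
      apply (symbol d).injective
      simp only [symbol_mul, symbol_one, act_one, Module.End.one_apply]
    mul_one := fun P => by
      apply (symbol d).injective
      simp only [symbol_mul, symbol_one, act_apply_one] }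

/-- The operator `∂`. -/
def D : DiffOp d := (symbol d).symm X

/-- Elements of `E` as operators of order zero (multiplication operators). -/
def coef : E →+* DiffOp d where
  toFun a := (symbol d).symm (C a)
  map_one' := rfl
  map_zero' := (symbol d).injective (by simp)
  map_add' a b := (symbol d).injective (by simp)
  map_mul' a b := (symbol d).injective (by
    rw [symbol_mul]
    simp only [AddEquiv.apply_symm_apply]
    rw [act, eval₂_C, mulC_apply, C_mul])

theorem symbol_D : symbol d (D d) = X := rfl

theorem symbol_coef (a : E) : symbol d (coef d a) = C a := rfl

/-- The coefficient of `∂ⁱ`. -/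
def coeff (P : DiffOp d) (i : ℕ) : E := (symbol d P).coeff i

/-- The order of a differential operator (`0` for the zero operator). -/
def order (P : DiffOp d) : ℕ := (symbol d P).natDegree

theorem D_mul_coef (a : E) : D d * coef d a = coef d a * D d + coef d (d a) := by
  apply (symbol d).injective
  have h : polyDeriv d (C a) = C (d a) := by
    ext i
    rw [coeff_polyDeriv, coeff_C, coeff_C]
    split_ifs <;> simp
  rw [map_add, symbol_mul, symbol_mul, symbol_D, symbol_coef, symbol_coef, act, act, eval₂_X,
    eval₂_C, mulD_apply, mulC_apply, h]
  ring

theorem symbol_coef_mul_D_pow (a : E) (n : ℕ) :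
    symbol d (coef d a * D d ^ n) = monomial n a := by
  have h : ∀ n : ℕ, act d (symbol d (D d ^ n)) = mulD d ^ n := by
    intro n
    induction n with
    | zero => rw [pow_zero, pow_zero, symbol_one, act_one]
    | succ n ih =>
      rw [pow_succ', symbol_mul, act_act, ih, pow_succ']
      congr 1
      simp [act, D]
  have h' : symbol d (D d ^ n) = X ^ n := by
    rw [← act_apply_one d (symbol d (D d ^ n)), h, mulD_pow_one]
  rw [symbol_mul, h', symbol_coef, act, eval₂_C, mulC_apply, C_mul_X_pow_eq_monomial]

/-- Every operator is `∑ aᵢ ∂ⁱ` with `aᵢ` its coefficients. -/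
theorem eq_sum (P : DiffOp d) :
    P = ∑ i ∈ Finset.range (order d P + 1), coef d (coeff d P i) * D d ^ i := by
  apply (symbol d).injective
  rw [map_sum]
  simp only [symbol_coef_mul_D_pow]
  exact (symbol d P).as_sum_range

variable {d} in
/-- Apply a ring homomorphism to the coefficients of an operator. -/
def map {F : Type*} [CommRing F] (f : E →+* F) (d' : Deriv F) (P : DiffOp d) :
    DiffOp d' := (symbol d').symm ((symbol d P).map f)

variable {d} in
/-- `R` is a right factor of `P`. -/
def IsRightFactor (R P : DiffOp d) : Prop := ∃ Q : DiffOp d, P = Q * R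

variable {d} in
/-- For operators `P`, `Q` of orders `n`, `m`, the square matrix of size `n + m - 2k` of the
coefficients of `∂^(m-1-k) P, …, ∂ P, P, ∂^(n-1-k) Q, …, ∂ Q, Q` (one row each), where the
columns are those of `∂^(n+m-k-1), …, ∂^(k+1)` followed by that of `∂^i` (`0 ≤ i ≤ k`). -/
def subresMatrix (n m k i : ℕ) (P Q : DiffOp d) :
    Matrix (Fin (n + m - 2 * k)) (Fin (n + m - 2 * k)) E :=
  Matrix.of fun r j =>
    coeff d
      (if (r : ℕ) < m - k then D d ^ (m - 1 - k - r) * P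
        else D d ^ (n - 1 - k - (r - (m - k))) * Q)
      (if (j : ℕ) + 1 < n + m - 2 * k then n + m - k - 1 - j else i)

variable {d} in
/-- The coefficient of `∂^i` in the `k`-th differential subresultant of `P` and `Q`. -/
def subresCoeff (k i : ℕ) (P Q : DiffOp d) : E :=
  (subresMatrix (order d P) (order d Q) k i P Q).det

variable {d} in
/-- The differential resultant, the determinant of the full Sylvester matrix; it is the case
`k = i = 0` above, where no column is removed. -/
def diffRes (P Q : DiffOp d) : E := subresCoeff 0 0 P Q

variable {d} in
/-- The Schrödinger operator `-∂² + u`. -/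
def schrodinger (d : Deriv E) (u : E) : DiffOp d := -(D d) ^ 2 + coef d u

end DiffOp

open DiffOp

/-! ## The formal KdV hierarchy -/

section Formal

variable (F : Type*) [Field F]

/-- The ring `F{u} = F[u, u', u'', …]` of differential polynomials; `X n` stands for `u⁽ⁿ⁾`. -/
abbrev DiffPoly : Type _ := MvPolynomial ℕ F

/-- The derivation of `F{u}` over `F`, with `∂ (u⁽ⁿ⁾) = u⁽ⁿ⁺¹⁾`. -/
def DiffPoly.deriv : Deriv (DiffPoly F) :=
  (MvPolynomial.mkDerivation F fun n : ℕ => (MvPolynomial.X (n + 1) : DiffPoly F)).restrictScalars ℤ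

/-- The differential indeterminate `u`. -/
def DiffPoly.u : DiffPoly F := MvPolynomial.X 0

variable {F}

open scoped Classical in
/-- The operation `∂⁻¹`: the differential polynomial `h` without constant term such that
`∂ h = g`, for `g` a total derivative (and the value `0` for any other `g`). -/
def DiffPoly.integ (g : DiffPoly F) : DiffPoly F :=
  if h : ∃ f : DiffPoly F, DiffPoly.deriv F f = g ∧ MvPolynomial.constantCoeff f = 0
  then h.choose else 0

variable (F) in
/-- `kdv₀ = u'`, `kdvₙ₊₁ = R (kdvₙ)`, where `R = -1/4 ∂² + u + 1/2 u' ∂⁻¹`. -/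
def kdv : ℕ → DiffPoly F
  | 0 => DiffPoly.deriv F (DiffPoly.u F)
  | n + 1 =>
    (-(1 / 4) : F) • DiffPoly.deriv F (DiffPoly.deriv F (kdv n)) + DiffPoly.u F * kdv n
      + (1 / 2 : F) • (DiffPoly.deriv F (DiffPoly.u F) * DiffPoly.integ (kdv n))

variable (F) in
/-- `v₀ = 1`, `vₙ₊₁ = R* (vₙ)`, where `R* = -1/4 ∂² + u - 1/2 ∂⁻¹ u'`. -/
def v : ℕ → DiffPoly F
  | 0 => 1
  | n + 1 =>
    (-(1 / 4) : F) • DiffPoly.deriv F (DiffPoly.deriv F (v n)) + DiffPoly.u F * v n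
      - (1 / 2 : F) • DiffPoly.integ (DiffPoly.deriv F (DiffPoly.u F) * v n)

variable (F) in
/-- The KdV differential operator `P_{2n+1}`: `P₁ = ∂` and
`P_{2n+3} = vₙ₊₁ ∂ - 1/2 ∂(vₙ₊₁) + P_{2n+1} L`, with `L = -∂² + u`. -/
def kdvOp : ℕ → DiffOp (DiffPoly.deriv F)
  | 0 => D _
  | n + 1 =>
    coef (DiffPoly.deriv F) (v F (n + 1)) * D (DiffPoly.deriv F)
      - coef (DiffPoly.deriv F) ((1 / 2 : F) • DiffPoly.deriv F (v F (n + 1)))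
      + kdvOp n * schrodinger (DiffPoly.deriv F) (DiffPoly.u F)

/-- `KdVₙ(u, c) = kdvₙ + ∑_{l < n} c_{n-l} kdv_l`; the entry `c i` is the constant `c_{i+1}`,
so that `c l.rev` is `c_{n-l}`. -/
def kdvExt (n : ℕ) (c : Fin n → F) : DiffPoly F :=
  kdv F n + ∑ l : Fin n, c l.rev • kdv F l

/-- The extended KdV operator `P_{2n+1} + ∑_{l < n} c_{n-l} P_{2l+1}`. -/
def kdvOpExt (n : ℕ) (c : Fin n → F) : DiffOp (DiffPoly.deriv F) :=
  kdvOp F n + ∑ l : Fin n, coef (DiffPoly.deriv F) (MvPolynomial.C (c l.rev)) * kdvOp F l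

end Formal

/-! ## KdV potentials in a differential field, and their spectral curves -/

section Potential

variable {K : Type*} [Field K] (d : Deriv K) (u : K)

/-- The value in `K` of a differential polynomial at the potential `u`. -/
def evalAt : DiffPoly (constants d) →ₐ[constants d] K :=
  MvPolynomial.aeval fun n : ℕ => (d^[n]) u

/-- The set `H_n` of the vectors of constants `c ∈ Cⁿ` with `KdVₙ(u, c) = 0`. -/
def kdvConstants (n : ℕ) : Set (Fin n → constants d) :=
  {c | evalAt d u (kdvExt n c) = 0}

/-- `u` is a KdV potential of KdV level `s`. -/
def IsKdVLevel (s : ℕ) : Prop :=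
  IsLeast {n : ℕ | 1 ≤ n ∧ (kdvConstants d u n).Nonempty} s

/-- The operator `A_{2s+1}` in `K[∂]`: the extended KdV operator at `u` and `c`. -/
def opA (s : ℕ) (c : Fin s → constants d) : DiffOp d :=
  (kdvOpExt s c).map (evalAt d u).toRingHom d

/-- The derivation of `K[λ, μ]` extending `d`, with `λ` and `μ` constant.  In `K[X][Y]` the
inner variable is `λ` and the outer one is `μ`. -/
abbrev derivLM : Deriv K[X][X] := polyDeriv (polyDeriv d)

/-- `L - λ` as an operator with coefficients in `K[λ, μ]`. -/
def opLlam : DiffOp (derivLM d) :=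
  (schrodinger d u).map ((C : K[X] →+* K[X][X]).comp C) (derivLM d) - coef (derivLM d) (C X)

/-- `A_{2s+1} - μ` as an operator with coefficients in `K[λ, μ]`. -/
def opAmu (s : ℕ) (c : Fin s → constants d) : DiffOp (derivLM d) :=
  (opA d u s c).map ((C : K[X] →+* K[X][X]).comp C) (derivLM d) - coef (derivLM d) X

/-- The polynomial `f_s`, the differential resultant of `L - λ` and `A_{2s+1} - μ`. -/
def spectralPoly (s : ℕ) (c : Fin s → constants d) : K[X][X] :=
  diffRes (opLlam d u) (opAmu d u s c)

/-- The spectral curve: the points `(λ₀, μ₀)` of `C²` where `f_s` vanishes. -/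
def spectralCurve (s : ℕ) (c : Fin s → constants d) : Set (constants d × constants d) :=
  {p | (spectralPoly d u s c).evalEval (p.1 : K) (p.2 : K) = 0}

/-- The coefficient `φ₁` of `1` in the first subresultant of `L - λ` and `A_{2s+1} - μ`. -/
def subresPhi₁ (s : ℕ) (c : Fin s → constants d) : K[X][X] :=
  subresCoeff 1 0 (opLlam d u) (opAmu d u s c)

/-- The coefficient `φ₂` of `∂` in the first subresultant of `L - λ` and `A_{2s+1} - μ`. -/
def subresPhi₂ (s : ℕ) (c : Fin s → constants d) : K[X][X] :=
  subresCoeff 1 1 (opLlam d u) (opAmu d u s c)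

end Potential

end KdV

end

/-! Right division of `A - μ` by `L - λ` carries the whole argument. Replacing `L` by `(L - λ) + λ`
in the recursion for the KdV operators gives `A - μ = W (L - λ) + (Φ ∂ - Φ'/2 - μ)`, where `Φ` is
the combination, with coefficients the `c_i` (and 1), of the sums `∑ v_j λ^(n-j)`
(`exists_kdvOpExt_eq`, `exists_opAmu_eq`). Row reduction of the Sylvester matrices leaves only
determinants of remainders (`det_subresMatrix`). Hence `φ₂ = Φ` and `φ₁ = -μ - Φ'/2`, that is `α =
Φ'/2`. With `b = Φ'/2 + μ` the resultant is `f = (Φ' - b) b + Φ (Φ (u - λ) - b')`.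

At a point with `Φ(λ₀) ≠ 0`, setting `φ = b/Φ` turns this into `f = -Φ² (φ' + φ² - (u - λ₀))`. So `f
= 0` is the Riccati equation that factors `L - λ₀`. The remainder of `A - μ₀` is `Φ(λ₀)(∂ - φ)`, so
`∂ - φ` is a right factor of `A - μ₀` as well.

Nonvanishing of `Φ(λ₀)` comes from minimality of the level (`kdvSumExt_ne_zero`). Since `kdv_n = 2 ∂
v_{n+1}`, the derivative `2 Φ(λ₀)'` is `kdv_{s-1}(u)` plus a constant combination of lower
`kdv_l(u)`. If it were zero, `u` would have a smaller level, or `u' = 0` when `s = 1`. The identity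
for `kdv_n` requires every `∂⁻¹` in the recursions to be a genuine antiderivative
(`mul_v_mem_range`). -/

namespace KdV

/-! ### Coefficients, top terms and orders of differential operators -/

namespace DiffOp

variable {E : Type*} [CommRing E] {d : Deriv E}

theorem coeff_ext {P Q : DiffOp d} (h : ∀ i, coeff d P i = coeff d Q i) : P = Q :=
  (symbol d).injective (Polynomial.ext h)

theorem coeff_zero (i : ℕ) : coeff d (0 : DiffOp d) i = 0 := by simp [coeff]

theorem coeff_add (P Q : DiffOp d) (i : ℕ) :
    coeff d (P + Q) i = coeff d P i + coeff d Q i := by simp [coeff]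

theorem coeff_sub (P Q : DiffOp d) (i : ℕ) :
    coeff d (P - Q) i = coeff d P i - coeff d Q i := by simp [coeff]

theorem coeff_neg (P : DiffOp d) (i : ℕ) : coeff d (-P) i = -coeff d P i := by simp [coeff]

theorem coeff_sum {ι : Type*} (t : Finset ι) (P : ι → DiffOp d) (i : ℕ) :
    coeff d (∑ j ∈ t, P j) i = ∑ j ∈ t, coeff d (P j) i := by
  simp [coeff, Polynomial.finsetSum_coeff]

theorem coeff_coef (a : E) (i : ℕ) : coeff d (coef d a) i = if i = 0 then a else 0 := by
  rw [coeff, symbol_coef, Polynomial.coeff_C]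

theorem coeff_coef_mul (a : E) (P : DiffOp d) (i : ℕ) :
    coeff d (coef d a * P) i = a * coeff d P i := by
  rw [coeff, symbol_mul, symbol_coef, act, eval₂_C, mulC_apply, Polynomial.coeff_C_mul, coeff]

theorem symbol_D_mul (P : DiffOp d) :
    symbol d (D d * P) = polyDeriv d (symbol d P) + X * symbol d P := by
  rw [symbol_mul, symbol_D, act, eval₂_X, mulD_apply]

theorem coeff_D_mul_zero (P : DiffOp d) : coeff d (D d * P) 0 = d (coeff d P 0) := by
  rw [coeff, symbol_D_mul, Polynomial.coeff_add, coeff_polyDeriv, coeff_X_mul_zero, add_zero,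
    coeff]

theorem coeff_D_mul_succ (P : DiffOp d) (i : ℕ) :
    coeff d (D d * P) (i + 1) = d (coeff d P (i + 1)) + coeff d P i := by
  rw [coeff, symbol_D_mul, Polynomial.coeff_add, coeff_polyDeriv, coeff_X_mul, coeff, coeff]

theorem coeff_D (i : ℕ) : coeff d (D d) i = if i = 1 then 1 else 0 := by
  rw [coeff, symbol_D, Polynomial.coeff_X]
  simp only [eq_comm]

theorem eq_sum_range {P : DiffOp d} {p : ℕ} (h : ∀ i, p ≤ i → coeff d P i = 0) :
    P = ∑ i ∈ Finset.range p, coef d (coeff d P i) * D d ^ i := by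
  apply (symbol d).injective
  rw [map_sum]
  simp only [symbol_coef_mul_D_pow]
  refine Polynomial.ext fun i => ?_
  rw [Polynomial.finsetSum_coeff]
  simp only [Polynomial.coeff_monomial, Finset.sum_ite_eq', Finset.mem_range]
  split_ifs with hi
  · rfl
  · exact h i (not_lt.1 hi)

theorem coeff_D_pow_mul_eq_zero {P : DiffOp d} {b : ℕ} (h : ∀ i, b < i → coeff d P i = 0)
    (n : ℕ) : ∀ i, n + b < i → coeff d (D d ^ n * P) i = 0 := by
  induction n with
  | zero => simpa using h
  | succ n ih =>
    intro i hi
    obtain ⟨i, rfl⟩ : ∃ j, i = j + 1 := ⟨i - 1, by omega⟩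
    rw [pow_succ', mul_assoc, coeff_D_mul_succ, ih _ (by omega), ih _ (by omega), map_zero,
      add_zero]

theorem coeff_D_pow_mul_top {P : DiffOp d} {b : ℕ} (h : ∀ i, b < i → coeff d P i = 0)
    (n : ℕ) : coeff d (D d ^ n * P) (n + b) = coeff d P b := by
  induction n with
  | zero => simp
  | succ n ih =>
    rw [pow_succ', mul_assoc, show n + 1 + b = n + b + 1 by ring, coeff_D_mul_succ,
      coeff_D_pow_mul_eq_zero h n _ (by omega), ih, map_zero, zero_add]

theorem coeff_mul_eq_zero {P Q : DiffOp d} {a b : ℕ} (hP : ∀ i, a < i → coeff d P i = 0)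
    (hQ : ∀ i, b < i → coeff d Q i = 0) (i : ℕ) (hi : a + b < i) : coeff d (P * Q) i = 0 := by
  rw [eq_sum_range (p := a + 1) (P := P) fun i hi => hP i hi, Finset.sum_mul, coeff_sum]
  refine Finset.sum_eq_zero fun j hj => ?_
  rw [Finset.mem_range] at hj
  rw [mul_assoc, coeff_coef_mul, coeff_D_pow_mul_eq_zero hQ j i (by omega), mul_zero]

theorem coeff_mul_top {P Q : DiffOp d} {a b : ℕ} (hP : ∀ i, a < i → coeff d P i = 0)
    (hQ : ∀ i, b < i → coeff d Q i = 0) :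
    coeff d (P * Q) (a + b) = coeff d P a * coeff d Q b := by
  conv_lhs => rw [eq_sum_range (p := a + 1) (P := P) fun i hi => hP i hi]
  rw [Finset.sum_mul, coeff_sum, Finset.sum_range_succ, Finset.sum_eq_zero, zero_add, mul_assoc,
    coeff_coef_mul, coeff_D_pow_mul_top hQ]
  intro j hj
  rw [Finset.mem_range] at hj
  rw [mul_assoc, coeff_coef_mul, coeff_D_pow_mul_eq_zero hQ j _ (by omega), mul_zero]

theorem order_eq {P : DiffOp d} {n : ℕ} (h : ∀ i, n < i → coeff d P i = 0)
    (hn : coeff d P n ≠ 0) : order d P = n :=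
  le_antisymm (natDegree_le_iff_coeff_eq_zero.2 h) (le_natDegree_of_ne_zero hn)

theorem coef_mul_comm_of_const {a : E} (ha : d a = 0) (P : DiffOp d) :
    P * coef d a = coef d a * P := by
  rw [eq_sum_range (P := P) (p := order d P + 1) fun i hi =>
    Polynomial.coeff_eq_zero_of_natDegree_lt hi, Finset.sum_mul, Finset.mul_sum]
  have hD : Commute (D d) (coef d a) := by
    rw [Commute, SemiconjBy, D_mul_coef, ha, map_zero, add_zero]
  refine Finset.sum_congr rfl fun i _ => ?_
  rw [mul_assoc, (hD.pow_left i).eq, ← mul_assoc, ← mul_assoc, ← map_mul, ← map_mul, mul_comm a]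

/-! ### Coefficientwise images of operators -/

section Map

variable {F G : Type*} [CommRing F] [CommRing G] {d' : Deriv F} {d'' : Deriv G} {f : E →+* F}

theorem coeff_map (P : DiffOp d) (i : ℕ) : coeff d' (P.map f d') i = f (coeff d P i) :=
  Polynomial.coeff_map _ _

theorem map_map (g : F →+* G) (P : DiffOp d) :
    (P.map f d').map g d'' = P.map (g.comp f) d'' :=
  coeff_ext fun i => by simp only [coeff_map, RingHom.comp_apply]

theorem map_add (P Q : DiffOp d) : (P + Q).map f d' = P.map f d' + Q.map f d' :=
  coeff_ext fun i => by simp only [coeff_map, coeff_add, _root_.map_add]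

theorem map_sub (P Q : DiffOp d) : (P - Q).map f d' = P.map f d' - Q.map f d' :=
  coeff_ext fun i => by simp only [coeff_map, coeff_sub, _root_.map_sub]

theorem map_neg (P : DiffOp d) : (-P).map f d' = -P.map f d' :=
  coeff_ext fun i => by simp only [coeff_map, coeff_neg, _root_.map_neg]

theorem map_sum {ι : Type*} (t : Finset ι) (P : ι → DiffOp d) :
    (∑ j ∈ t, P j).map f d' = ∑ j ∈ t, (P j).map f d' :=
  coeff_ext fun i => by simp only [coeff_map, coeff_sum, _root_.map_sum]

theorem map_coef (a : E) : (coef d a).map f d' = coef d' (f a) :=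
  coeff_ext fun i => by simp only [coeff_map, coeff_coef, apply_ite f, map_zero]

theorem map_D : (D d).map f d' = D d' :=
  coeff_ext fun i => by simp only [coeff_map, coeff_D, apply_ite f, map_zero, map_one]

theorem map_coef_mul (a : E) (P : DiffOp d) :
    (coef d a * P).map f d' = coef d' (f a) * P.map f d' :=
  coeff_ext fun i => by simp only [coeff_map, coeff_coef_mul, map_mul]

theorem map_D_mul (h : ∀ x, f (d x) = d' (f x)) (P : DiffOp d) :
    (D d * P).map f d' = D d' * P.map f d' :=
  coeff_ext fun i => by
    cases i <;> simp only [coeff_map, coeff_D_mul_zero, coeff_D_mul_succ, _root_.map_add, h]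

theorem map_D_pow_mul (h : ∀ x, f (d x) = d' (f x)) (n : ℕ) (P : DiffOp d) :
    (D d ^ n * P).map f d' = D d' ^ n * P.map f d' := by
  induction n with
  | zero => simp
  | succ n ih => rw [pow_succ', mul_assoc, map_D_mul h, ih, pow_succ', mul_assoc]

theorem map_mul (h : ∀ x, f (d x) = d' (f x)) (P Q : DiffOp d) :
    (P * Q).map f d' = P.map f d' * Q.map f d' := by
  have hP : ∀ i, order d P + 1 ≤ i → coeff d P i = 0 := fun i hi =>
    Polynomial.coeff_eq_zero_of_natDegree_lt hi
  have hP' : ∀ i, order d P + 1 ≤ i → coeff d' (P.map f d') i = 0 := fun i hi => by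
    rw [coeff_map, hP i hi, map_zero]
  conv_lhs => rw [eq_sum_range hP]
  rw [eq_sum_range hP', Finset.sum_mul, Finset.sum_mul, map_sum]
  refine Finset.sum_congr rfl fun i _ => ?_
  rw [mul_assoc, map_coef_mul, map_D_pow_mul h, mul_assoc, coeff_map]

theorem map_schrodinger (h : ∀ x, f (d x) = d' (f x)) (u : E) :
    (schrodinger d u).map f d' = schrodinger d' (f u) := by
  rw [schrodinger, schrodinger, map_add, map_neg, map_coef, pow_two, map_D_mul h, map_D, pow_two]

end Map

theorem schrodinger_sub_coef (u a : E) :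
    schrodinger d u - coef d a = schrodinger d (u - a) := by
  rw [schrodinger, schrodinger, _root_.map_sub, add_sub_assoc]

theorem coeff_schrodinger (u : E) (i : ℕ) :
    coeff d (schrodinger d u) i = if i = 2 then -1 else if i = 0 then u else 0 := by
  have h2 : coeff d (D d ^ 2) i = if i = 2 then 1 else 0 := by
    rw [← one_mul (D d ^ 2), ← map_one (coef d), coeff, symbol_coef_mul_D_pow,
      Polynomial.coeff_monomial]
    simp only [eq_comm]
  rw [schrodinger, coeff_add, coeff_neg, h2, coeff_coef]
  rcases i with _ | _ | _ | i <;> simp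

theorem coeff_schrodinger_eq_zero (u : E) (i : ℕ) (hi : 2 < i) :
    coeff d (schrodinger d u) i = 0 := by
  rw [coeff_schrodinger, if_neg (by omega), if_neg (by omega)]

theorem coeff_schrodinger_two (u : E) : coeff d (schrodinger d u) 2 = -1 := by
  rw [coeff_schrodinger, if_pos rfl]

/-- The cross terms `∂ a - a ∂` contribute exactly `a'`, so the product is `-∂² + a' + a²`. -/
theorem schrodinger_factor {u a : E} (h : d a + a ^ 2 = u) :
    schrodinger d u = (-(D d) - coef d a) * (D d - coef d a) := by
  have h1 : (-(D d) - coef d a) * (D d - coef d a)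
      = -(D d) ^ 2 + D d * coef d a - coef d a * D d + coef d a * coef d a := by noncomm_ring
  rw [h1, D_mul_coef, schrodinger, ← h, _root_.map_add, pow_two a, _root_.map_mul]
  abel

/-! ### Determinants of rows of operators -/

/-- Reduction of the rows of a differential Sylvester matrix modulo an operator of order two. -/
theorem det_fromBlocks_rows {P : DiffOp d} (hP : ∀ i, 2 < i → coeff d P i = 0)
    (hP2 : coeff d P 2 = -1) {p q : ℕ} {T W R : Fin q → DiffOp d}
    (hT : ∀ e, T e = W e * P + R e) (hW : ∀ e i, p ≤ i → coeff d (W e) i = 0)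
    (hR : ∀ e i, 2 ≤ i → coeff d (R e) i = 0) (col : Fin q → ℕ) :
    (Matrix.fromBlocks
      (Matrix.of fun r j : Fin p => coeff d (D d ^ (p - 1 - r : ℕ) * P) (p + 1 - j))
      (Matrix.of fun (r : Fin p) j => coeff d (D d ^ (p - 1 - r : ℕ) * P) (col j))
      (Matrix.of fun e (j : Fin p) => coeff d (T e) (p + 1 - j))
      (Matrix.of fun e j => coeff d (T e) (col j))).det
      = (-1) ^ p * (Matrix.of fun e j => coeff d (R e) (col j)).det := by
  set A := Matrix.of fun r j : Fin p => coeff d (D d ^ (p - 1 - r : ℕ) * P) (p + 1 - j) with hA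
  set B := Matrix.of fun (r : Fin p) (j : Fin q) => coeff d (D d ^ (p - 1 - r : ℕ) * P) (col j)
    with hB
  set S := Matrix.of fun e j : Fin q => coeff d (R e) (col j) with hS
  let Y : Matrix (Fin q) (Fin p) E := Matrix.of fun e r => coeff d (W e) (p - 1 - r)
  -- As `W e` has order below `p`, the row of `W e * P` is a combination of the rows `∂^(p-1-r) P`,
  -- with coefficients collected in `Y`.
  have key : ∀ e i, coeff d (W e * P) i
      = ∑ r : Fin p, coeff d (W e) (p - 1 - r) * coeff d (D d ^ (p - 1 - r : ℕ) * P) i := by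
    intro e i
    conv_lhs => rw [eq_sum_range (hW e)]
    rw [Finset.sum_mul, coeff_sum, ← Finset.sum_range_reflect, Finset.sum_range]
    simp only [mul_assoc, coeff_coef_mul]
  have h1 : (Matrix.of fun e (j : Fin p) => coeff d (T e) (p + 1 - j)) = Y * A := by
    ext e j
    rw [Matrix.mul_apply, Matrix.of_apply, hT, coeff_add, hR e _ (by omega), add_zero, key]
    rfl
  have h2 : (Matrix.of fun e j => coeff d (T e) (col j)) = Y * B + S := by
    ext e j
    rw [Matrix.add_apply, Matrix.mul_apply, Matrix.of_apply, hT, coeff_add, key]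
    rfl
  -- Subtracting those rows leaves the remainders, which vanish in the columns `∂^(p+1), …, ∂²`.
  have h3 : Matrix.fromBlocks A B (Y * A) (Y * B + S)
      = Matrix.fromBlocks 1 0 Y 1 * Matrix.fromBlocks A B 0 S := by
    rw [Matrix.fromBlocks_multiply]
    simp
  -- Row `r` has order `(p - 1 - r) + 2`, the index of column `r`, and leading coefficient `-1`.
  have h4 : A.det = (-1) ^ p := by
    rw [Matrix.det_of_isUpperTriangular]
    · rw [Finset.prod_eq_pow_card (b := -1), Finset.card_univ, Fintype.card_fin]
      intro r _
      rw [hA, Matrix.of_apply, show p + 1 - (r : ℕ) = (p - 1 - r) + 2 by omega,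
        coeff_D_pow_mul_top hP, hP2]
    · intro r j hrj
      have : (j : ℕ) < r := hrj
      exact coeff_D_pow_mul_eq_zero hP _ _ (by omega)
  rw [h1, h2, h3, Matrix.det_mul, Matrix.det_fromBlocks_zero₁₂, Matrix.det_fromBlocks_zero₂₁, h4]
  simp

/-- The differential subresultants of an operator `P` of order two and an operator of order `m`
in terms of remainders on right division by `P`. -/
theorem det_subresMatrix {P Q : DiffOp d} (hP : ∀ i, 2 < i → coeff d P i = 0)
    (hP2 : coeff d P 2 = -1) {p q m k i : ℕ} (hm : m = p + k) (hk : q + k = 2) (hq : 0 < q)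
    {W R : Fin q → DiffOp d}
    (hT : ∀ e : Fin q, D d ^ (q - 1 - e : ℕ) * Q = W e * P + R e)
    (hW : ∀ e i, p ≤ i → coeff d (W e) i = 0) (hR : ∀ e i, 2 ≤ i → coeff d (R e) i = 0) :
    (subresMatrix 2 m k i P Q).det = (-1) ^ p *
      (Matrix.of fun e j : Fin q => coeff d (R e) (if (j : ℕ) + 1 < q then 1 else i)).det := by
  rw [← det_fromBlocks_rows hP hP2 hT hW hR fun j : Fin q => if (j : ℕ) + 1 < q then 1 else i]
  let ε : Fin p ⊕ Fin q ≃ Fin (2 + m - 2 * k) :=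
    finSumFinEquiv.trans (finCongr (by omega))
  rw [← Matrix.det_submatrix_equiv_self ε]
  congr 1
  have hl : ∀ r : Fin p, (ε (Sum.inl r) : ℕ) = r := fun r => rfl
  have hr : ∀ e : Fin q, (ε (Sum.inr e) : ℕ) = p + e := fun r => rfl
  ext a b
  rw [Matrix.submatrix_apply, subresMatrix, Matrix.of_apply]
  rcases a with r | r <;> rcases b with j | j <;>
    simp only [hl, hr, Matrix.fromBlocks_apply₁₁, Matrix.fromBlocks_apply₁₂,
      Matrix.fromBlocks_apply₂₁, Matrix.fromBlocks_apply₂₂, Matrix.of_apply]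
  · rw [if_pos (by omega), if_pos (by omega)]
    congr 2 <;> first | omega | (congr 1; omega)
  · rw [if_pos (by omega)]
    congr 1
    · congr 2; omega
    · split_ifs <;> omega
  · rw [if_neg (by omega), if_pos (by omega)]
    congr 1
    · congr 2; omega
    · omega
  · rw [if_neg (by omega)]
    congr 1
    · congr 2; omega
    · split_ifs <;> omega

end DiffOp

/-! ## Locality of the KdV hierarchy -/

namespace DiffPoly

variable {F : Type*} [Field F]

theorem deriv_apply (p : DiffPoly F) : deriv F p =
    MvPolynomial.mkDerivation F (fun n : ℕ => (MvPolynomial.X (n + 1) : DiffPoly F)) p := rfl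

theorem deriv_C (a : F) : deriv F (MvPolynomial.C a) = 0 :=
  MvPolynomial.derivation_C _ a

theorem deriv_X (n : ℕ) : deriv F (MvPolynomial.X n) = MvPolynomial.X (n + 1) :=
  MvPolynomial.mkDerivation_X _ _ n

theorem deriv_smul (a : F) (p : DiffPoly F) : deriv F (a • p) = a • deriv F p := by
  simp only [deriv_apply, Derivation.map_smul]

theorem deriv_mul (p q : DiffPoly F) : deriv F (p * q) = p * deriv F q + q * deriv F p :=
  (deriv F).leibniz p q

theorem constantCoeff_deriv (p : DiffPoly F) :
    MvPolynomial.constantCoeff (deriv F p) = 0 := by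
  induction p using MvPolynomial.induction_on with
  | C a => rw [deriv_C, map_zero]
  | add p q hp hq => rw [map_add, map_add, hp, hq, add_zero]
  | mul_X p n hp => simp [deriv_X, hp]

theorem constantCoeff_u : MvPolynomial.constantCoeff (u F) = 0 :=
  MvPolynomial.constantCoeff_X _ 0

/-- The commutator of `∂/∂u⁽ⁿ⁺¹⁾` with the total derivation is `∂/∂u⁽ⁿ⁾`. This drives the descent
showing that only constants have zero derivative. -/
theorem pderiv_succ_deriv (n : ℕ) (p : DiffPoly F) :
    MvPolynomial.pderiv (n + 1) (deriv F p)
      = deriv F (MvPolynomial.pderiv (n + 1) p) + MvPolynomial.pderiv n p := by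
  induction p using MvPolynomial.induction_on with
  | C a => simp [deriv_C]
  | add p q hp hq => simp only [map_add, hp, hq]; ring
  | mul_X p m hp =>
    have h : MvPolynomial.pderiv (n + 1) (MvPolynomial.X (m + 1) : DiffPoly F)
        = MvPolynomial.pderiv n (MvPolynomial.X m) := by
      simp [MvPolynomial.pderiv_X, Pi.single_apply]
    have h' : deriv F (MvPolynomial.pderiv (n + 1) (MvPolynomial.X m : DiffPoly F)) = 0 := by
      rw [MvPolynomial.pderiv_X, Pi.single_apply]
      split_ifs <;> simp
    simp only [deriv_mul, deriv_X, MvPolynomial.pderiv_mul, map_add, hp, h, h']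
    ring

theorem eq_zero_of_deriv_eq_zero [CharZero F] {p : DiffPoly F} (hp : deriv F p = 0)
    (h0 : MvPolynomial.constantCoeff p = 0) : p = 0 := by
  have hstep : ∀ n, MvPolynomial.pderiv (n + 1) p = 0 → MvPolynomial.pderiv n p = 0 := by
    intro n hn
    have := pderiv_succ_deriv n p
    rw [hp, hn, map_zero, map_zero, zero_add] at this
    exact this.symm
  have hdown : ∀ k n, MvPolynomial.pderiv (n + k) p = 0 → MvPolynomial.pderiv n p = 0 := by
    intro k
    induction k with
    | zero => exact fun n h => h
    | succ k ih => exact fun n h => ih n (hstep _ h)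
  have hall : ∀ n, MvPolynomial.pderiv n p = 0 := by
    intro n
    -- The descent starts at an index beyond every variable of `p`, where the partial derivative is
    -- trivially zero.
    refine hdown (p.vars.sup id + 1) n (MvPolynomial.pderiv_eq_zero_of_notMem_vars fun h => ?_)
    have : n + (p.vars.sup id + 1) ≤ p.vars.sup id := Finset.le_sup (f := id) h
    omega
  ext m
  rw [MvPolynomial.coeff_zero]
  by_cases hm : m = 0
  · rw [hm, ← MvPolynomial.constantCoeff_eq, h0]
  · obtain ⟨n, hn⟩ := Finsupp.ne_iff.1 hm
    have h1 := MvPolynomial.coeff_pderiv (i := n) p (m - Finsupp.single n 1)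
    rw [hall, MvPolynomial.coeff_zero, tsub_add_cancel_of_le] at h1
    · exact (mul_eq_zero.1 h1.symm).resolve_right (Nat.cast_add_one_ne_zero _)
    · rw [Finsupp.single_le_iff]
      exact Nat.one_le_iff_ne_zero.2 hn

theorem integ_deriv [CharZero F] {p : DiffPoly F} (h0 : MvPolynomial.constantCoeff p = 0) :
    integ (deriv F p) = p := by
  have h : ∃ f : DiffPoly F, deriv F f = deriv F p ∧ MvPolynomial.constantCoeff f = 0 :=
    ⟨p, rfl, h0⟩
  rw [integ, dif_pos h, ← sub_eq_zero]
  apply eq_zero_of_deriv_eq_zero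
  · rw [map_sub, h.choose_spec.1, sub_self]
  · rw [map_sub, h.choose_spec.2, h0, sub_self]

theorem constantCoeff_integ (p : DiffPoly F) :
    MvPolynomial.constantCoeff (integ p) = 0 := by
  rw [integ]
  split_ifs with h
  · exact h.choose_spec.2
  · exact map_zero _

theorem deriv_integ {p : DiffPoly F} (hp : p ∈ (deriv F).toLinearMap.range) :
    deriv F (integ p) = p := by
  obtain ⟨f, hf⟩ := hp
  have h : ∃ f : DiffPoly F, deriv F f = p ∧ MvPolynomial.constantCoeff f = 0 := by
    refine ⟨f - MvPolynomial.C (MvPolynomial.constantCoeff f), ?_, by simp⟩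
    rw [map_sub, deriv_C, sub_zero]
    exact hf
  rw [integ, dif_pos h]
  exact h.choose_spec.1

/-! ### Lenard's recursion: the antiderivatives exist -/

variable (F) in
/-- The third-order operator `-1/4 ∂³ + u ∂ + 1/2 u'` of Lenard's recursion. -/
noncomputable def lenard (p : DiffPoly F) : DiffPoly F :=
  (-(1 / 4) : F) • deriv F (deriv F (deriv F p)) + u F * deriv F p
    + (1 / 2 : F) • (deriv F (u F) * p)

/-- The operator is skew-adjoint: integration by parts makes `p ℓ(q) + q ℓ(p)` a total derivative,
and the witness is the resulting boundary term. -/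
theorem lenard_skew [CharZero F] (p q : DiffPoly F) :
    p * lenard F q + q * lenard F p ∈ (deriv F).toLinearMap.range := by
  refine ⟨(-(1 / 4) : F) • (p * deriv F (deriv F q) + q * deriv F (deriv F p)
    - deriv F p * deriv F q) + u F * (p * q), ?_⟩
  have h : (MvPolynomial.C (1 / 2) : DiffPoly F) + MvPolynomial.C (1 / 2) = 1 := by
    rw [← MvPolynomial.C_add, add_halves, MvPolynomial.C_1]
  simp only [Derivation.coeFn_coe, map_add, map_sub, deriv_C, deriv_mul, lenard,
    MvPolynomial.smul_eq_C_mul]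
  linear_combination (-(deriv F (u F)) * p * q) * h

theorem mem_range_of_two_mul [CharZero F] {p : DiffPoly F}
    (h : p + p ∈ (deriv F).toLinearMap.range) : p ∈ (deriv F).toLinearMap.range := by
  obtain ⟨f, hf⟩ := h
  refine ⟨(1 / 2 : F) • f, ?_⟩
  rw [Derivation.coeFn_coe] at hf ⊢
  rw [deriv_smul, hf, smul_add, ← add_smul, add_halves, one_smul]

theorem smul_mem_range (a : F) {p : DiffPoly F}
    (h : p ∈ (deriv F).toLinearMap.range) : a • p ∈ (deriv F).toLinearMap.range := by
  obtain ⟨f, hf⟩ := h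
  refine ⟨a • f, ?_⟩
  rw [Derivation.coeFn_coe] at hf ⊢
  rw [deriv_smul, hf]

theorem mul_deriv_add_mem_range (p q : DiffPoly F) :
    p * deriv F q + q * deriv F p ∈ (deriv F).toLinearMap.range :=
  ⟨p * q, deriv_mul p q⟩

theorem constantCoeff_v_succ (n : ℕ) : MvPolynomial.constantCoeff (v F (n + 1)) = 0 := by
  rw [v]
  simp [MvPolynomial.smul_eq_C_mul, constantCoeff_deriv, constantCoeff_integ, constantCoeff_u]

theorem lenard_one : lenard F (v F 0) = (1 / 2 : F) • deriv F (u F) := by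
  simp [lenard, v]

theorem deriv_v_succ_of_mem_range [CharZero F] {n : ℕ}
    (h : deriv F (u F) * v F n ∈ (deriv F).toLinearMap.range) :
    deriv F (v F (n + 1)) = lenard F (v F n) := by
  have h2 : (MvPolynomial.C (1 / 2) : DiffPoly F) + MvPolynomial.C (1 / 2) = 1 := by
    rw [← MvPolynomial.C_add, add_halves, MvPolynomial.C_1]
  rw [v, lenard, map_sub, map_add, deriv_smul, deriv_smul, deriv_integ h, deriv_mul]
  simp only [MvPolynomial.smul_eq_C_mul]
  linear_combination (-(deriv F (u F)) * v F n) * h2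

/-- Write `ℓ` for `lenard F`. Modulo total derivatives, `v_j ℓ(v_k) ≡ v_{j-1} ℓ(v_{k+1})`, by
`v_{i+1}' = ℓ(v_i)`, the product rule and skewness. Shifting all the way gives `v_n ℓ(v_0) ≡ v_0
ℓ(v_n) ≡ -v_n ℓ(v_0)`. Hence `2 v_n ℓ(v_0) = u' v_n` is a total derivative. Strong induction
provides the recursion at the smaller indices. -/
theorem mul_v_mem_range [CharZero F] (n : ℕ) :
    deriv F (u F) * v F n ∈ (deriv F).toLinearMap.range := by
  induction n using Nat.strong_induction_on with
  | _ n ih =>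
  have hk : ∀ k j, k + j = n → v F n * lenard F (v F 0) - v F j * lenard F (v F k)
      ∈ (deriv F).toLinearMap.range := by
    intro k
    induction k with
    | zero =>
      intro j hj
      rw [← hj, zero_add, sub_self]
      exact zero_mem _
    | succ k ihk =>
      intro j hj
      have h1 := ihk (j + 1) (by omega)
      have h2 := mul_deriv_add_mem_range (v F (j + 1)) (v F (k + 1))
      rw [deriv_v_succ_of_mem_range (ih k (by omega)),
        deriv_v_succ_of_mem_range (ih j (by omega))] at h2
      convert sub_mem (add_mem h1 h2) (lenard_skew (v F j) (v F (k + 1))) using 1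
      ring
  have h3 := add_mem (hk n 0 (by omega)) (lenard_skew (v F 0) (v F n))
  have h4 : v F n * lenard F (v F 0) ∈ (deriv F).toLinearMap.range := by
    apply mem_range_of_two_mul
    convert h3 using 1
    ring
  have h5 := smul_mem_range 2 h4
  rw [lenard_one, mul_smul_comm, smul_smul, mul_one_div_cancel two_ne_zero, one_smul, mul_comm]
    at h5
  exact h5

theorem deriv_v_succ [CharZero F] (n : ℕ) : deriv F (v F (n + 1)) = lenard F (v F n) :=
  deriv_v_succ_of_mem_range (mul_v_mem_range n)

/-- Inductively `∂⁻¹ kdv_n` is `2 v_{n+1}`, because `v_{n+1}` has no constant term; the recursion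
for `kdv` then becomes twice the derivative of Lenard's. -/
theorem kdv_eq [CharZero F] (n : ℕ) : kdv F n = (2 : F) • deriv F (v F (n + 1)) := by
  induction n with
  | zero =>
    rw [deriv_v_succ, lenard_one, smul_smul, mul_one_div_cancel two_ne_zero, one_smul, kdv]
  | succ n ih =>
    have h0 : MvPolynomial.constantCoeff ((2 : F) • v F (n + 1)) = 0 := by
      simp [MvPolynomial.smul_eq_C_mul, constantCoeff_v_succ]
    have h1 : integ ((2 : F) • deriv F (v F (n + 1))) = (2 : F) • v F (n + 1) := by
      rw [← deriv_smul, integ_deriv h0]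
    rw [kdv, ih, h1, deriv_v_succ (n + 1), lenard]
    simp only [deriv_smul]
    simp only [MvPolynomial.smul_eq_C_mul]
    ring

end DiffPoly

open DiffOp hiding map_add map_sub map_neg map_sum map_mul

/-! ## Right division of the KdV operators by `L - λ` -/

theorem coeff_kdvOp {F : Type*} [Field F] (n : ℕ) :
    (∀ i, 2 * n + 1 < i → coeff (DiffPoly.deriv F) (kdvOp F n) i = 0) ∧
      coeff (DiffPoly.deriv F) (kdvOp F n) (2 * n + 1) = (-1) ^ n := by
  induction n with
  | zero =>
    refine ⟨fun i hi => ?_, ?_⟩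
    · rw [kdvOp, coeff_D, if_neg (by omega)]
    · rw [kdvOp, coeff_D, if_pos (by omega), pow_zero]
  | succ n ih =>
    have h := coeff_schrodinger_eq_zero (d := DiffPoly.deriv F) (DiffPoly.u F)
    refine ⟨fun i hi => ?_, ?_⟩
    · rw [kdvOp, DiffOp.coeff_add, DiffOp.coeff_sub, coeff_coef_mul, coeff_D, coeff_coef,
        coeff_mul_eq_zero ih.1 h i (by omega), if_neg (by omega), if_neg (by omega)]
      simp
    · rw [kdvOp, DiffOp.coeff_add, DiffOp.coeff_sub, coeff_coef_mul, coeff_D, coeff_coef,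
        show 2 * (n + 1) + 1 = 2 * n + 1 + 2 by ring, coeff_mul_top ih.1 h, ih.2,
        coeff_schrodinger_two, if_neg (by omega), if_neg (by omega)]
      ring

theorem coeff_kdvOpExt {F : Type*} [Field F] (n : ℕ) (c : Fin n → F) :
    (∀ i, 2 * n + 1 < i → coeff (DiffPoly.deriv F) (kdvOpExt n c) i = 0) ∧
      coeff (DiffPoly.deriv F) (kdvOpExt n c) (2 * n + 1) = (-1) ^ n := by
  have h : ∀ i, 2 * n + 1 ≤ i → coeff (DiffPoly.deriv F) (∑ l : Fin n,
      coef (DiffPoly.deriv F) (MvPolynomial.C (c l.rev)) * kdvOp F l) i = 0 := by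
    intro i hi
    rw [DiffOp.coeff_sum]
    refine Finset.sum_eq_zero fun l _ => ?_
    rw [coeff_coef_mul, (coeff_kdvOp (l : ℕ)).1 i (by omega), mul_zero]
  refine ⟨fun i hi => ?_, ?_⟩
  · rw [kdvOpExt, DiffOp.coeff_add, (coeff_kdvOp n).1 i hi, h i hi.le, add_zero]
  · rw [kdvOpExt, DiffOp.coeff_add, (coeff_kdvOp n).2, h _ le_rfl, add_zero]

section Division

variable {F E : Type*} [Field F] [CommRing E] {d : Deriv E} (f : DiffPoly F →+* E) (lam : E)

/-- The polynomials `∑_{j ≤ n} v_j λ^(n - j)`, with `v_j` replaced by its image under `f`. -/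
noncomputable def kdvSum : ℕ → E
  | 0 => 1
  | n + 1 => f (v F (n + 1)) + lam * kdvSum n

/-- The coefficient of `∂` in the remainder of the extended KdV operator modulo `L - λ`. -/
noncomputable def kdvSumExt (n : ℕ) (c : Fin n → F) : E :=
  kdvSum f lam n + ∑ l : Fin n, f (MvPolynomial.C (c l.rev)) * kdvSum f lam l

theorem map_kdvSum {E' : Type*} [CommRing E'] (g : E →+* E') (n : ℕ) :
    g (kdvSum f lam n) = kdvSum (g.comp f) (g lam) n := by
  induction n with
  | zero => exact map_one g
  | succ n ih => rw [kdvSum, kdvSum, map_add, map_mul, ih, RingHom.comp_apply]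

theorem map_kdvSumExt {E' : Type*} [CommRing E'] (g : E →+* E') (n : ℕ) (c : Fin n → F) :
    g (kdvSumExt f lam n c) = kdvSumExt (g.comp f) (g lam) n c := by
  simp only [kdvSumExt, map_add, map_sum, map_mul, map_kdvSum, RingHom.comp_apply]

variable {f lam} (hf : ∀ p, f (DiffPoly.deriv F p) = d (f p)) (hlam : d lam = 0)

include hf in
theorem deriv_map_C (a : F) : d (f (MvPolynomial.C a)) = 0 := by
  rw [← hf, DiffPoly.deriv_C, map_zero]

include hf hlam in
-- Stated for any differential homomorphism `f` and constant `lam`, so that it serves both over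
-- `K[λ, μ]` and, after specialization at `λ₀`, over `K`.
theorem exists_kdvOp_eq (n : ℕ) : ∃ W : DiffOp d, (∀ i, 2 * n ≤ i → coeff d W i = 0) ∧
    (kdvOp F n).map f d = W * (schrodinger d (f (DiffPoly.u F)) - coef d lam)
      + (coef d (kdvSum f lam n) * D d
        - coef d (f (MvPolynomial.C (1 / 2)) * d (kdvSum f lam n))) := by
  induction n with
  | zero =>
    refine ⟨0, fun i _ => DiffOp.coeff_zero i, ?_⟩
    simp [kdvOp, map_D, kdvSum]
  | succ n ih =>
    obtain ⟨W, hW, h⟩ := ih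
    -- From `P L = P (L - λ) + λ P`, valid because the constant `λ` is central: the first summand
    -- joins the quotient, and only the second `P` is divided again.
    refine ⟨(kdvOp F n).map f d + coef d lam * W, fun i hi => ?_, ?_⟩
    · rw [DiffOp.coeff_add, DiffOp.coeff_map, coeff_coef_mul, (coeff_kdvOp n).1 i (by omega),
        hW i (by omega), map_zero, mul_zero, add_zero]
    · have hc := coef_mul_comm_of_const hlam ((kdvOp F n).map f d)
      rw [kdvOp, DiffOp.map_add, DiffOp.map_sub, map_coef_mul, map_D, map_coef,
        DiffOp.map_mul hf, map_schrodinger hf, MvPolynomial.smul_eq_C_mul, map_mul, hf,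
        kdvSum, map_add, map_add, Derivation.leibniz, hlam, smul_zero, add_zero, smul_eq_mul,
        mul_add (f _), map_add, map_mul (coef d) lam, add_mul (coef d _), mul_left_comm _ lam,
        map_mul (coef d) lam]
      calc _ = (kdvOp F n).map f d * (schrodinger d (f (DiffPoly.u F)) - coef d lam)
              + (kdvOp F n).map f d * coef d lam
              + (coef d (f (v F (n + 1))) * D d
                - coef d (f (MvPolynomial.C (1 / 2)) * d (f (v F (n + 1))))) := by noncomm_ring
        _ = _ := by
          rw [hc]
          conv_lhs =>
            enter [1, 2]
            rw [h]
          noncomm_ring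

include hf hlam in
theorem exists_kdvOpExt_eq (n : ℕ) (c : Fin n → F) :
    ∃ W : DiffOp d, (∀ i, 2 * n ≤ i → coeff d W i = 0) ∧
      (kdvOpExt n c).map f d = W * (schrodinger d (f (DiffPoly.u F)) - coef d lam)
        + (coef d (kdvSumExt f lam n c) * D d
          - coef d (f (MvPolynomial.C (1 / 2)) * d (kdvSumExt f lam n c))) := by
  choose W hW h using exists_kdvOp_eq hf hlam
  refine ⟨W n + ∑ l : Fin n, coef d (f (MvPolynomial.C (c l.rev))) * W l, fun i hi => ?_, ?_⟩
  · rw [DiffOp.coeff_add, DiffOp.coeff_sum, hW n i hi, Finset.sum_eq_zero, add_zero]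
    intro l _
    rw [coeff_coef_mul, hW l i (by omega), mul_zero]
  · have hd : d (kdvSumExt f lam n c) = d (kdvSum f lam n)
        + ∑ l : Fin n, f (MvPolynomial.C (c l.rev)) * d (kdvSum f lam l) := by
      simp only [kdvSumExt, map_add, map_sum, Derivation.leibniz, deriv_map_C hf, smul_eq_mul,
        mul_zero, add_zero]
    rw [hd, kdvOpExt, DiffOp.map_add, DiffOp.map_sum, h, kdvSumExt, map_add, map_sum, mul_add,
      map_add, Finset.mul_sum, map_sum]
    simp only [map_coef_mul, h, mul_left_comm (f (MvPolynomial.C (1 / 2))), map_mul (coef d),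
      mul_add, mul_sub, add_mul, Finset.sum_add_distrib, Finset.sum_sub_distrib, Finset.sum_mul,
      mul_assoc]
    abel

end Division

/-! ## Subresultants and the resultant -/

section Subres

variable {E : Type*} [CommRing E] {d : Deriv E} {u a b : E} {s : ℕ} {W Q : DiffOp d}
  (hW : ∀ i, 2 * s ≤ i → coeff d W i = 0)
  (hQ : Q = W * schrodinger d u + (coef d a * D d - coef d b))

theorem coeff_linear (a b : E) (i : ℕ) :
    coeff d (coef d a * D d - coef d b) i = if i = 0 then -b else if i = 1 then a else 0 := by
  rw [DiffOp.coeff_sub, coeff_coef_mul, coeff_D, coeff_coef]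
  rcases i with _ | _ | i <;> simp

include hW hQ in
theorem det_subresMatrix_one (i : ℕ) :
    (subresMatrix 2 (2 * s + 1) 1 i (schrodinger d u) Q).det
      = coeff d (coef d a * D d - coef d b) i := by
  rw [det_subresMatrix (p := 2 * s) (q := 1) (coeff_schrodinger_eq_zero u)
    (coeff_schrodinger_two u) rfl rfl one_pos (W := fun _ => W)
    (R := fun _ => coef d a * D d - coef d b) (fun e => by simpa using hQ) (fun _ => hW)
    fun _ i hi => by rw [coeff_linear, if_neg (by omega), if_neg (by omega)]]
  simp [Matrix.det_unique, pow_mul]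

include hW hQ in
-- Two rows `∂ Q`, `Q` survive the reduction. Replacing `a ∂²` by `-a L + a u` in `∂ (a ∂ - b)`
-- gives the remainder `(a' - b) ∂ - (b' - a u)`. The sign `(-1)^(2s+1)` then flips the 2 × 2
-- determinant.
theorem det_subresMatrix_zero :
    (subresMatrix 2 (2 * s + 1) 0 0 (schrodinger d u) Q).det
      = (d a - b) * b + a * (a * u - d b) := by
  let W' : DiffOp d := D d * W - coef d a
  let R' : DiffOp d := coef d (d a - b) * D d - coef d (d b - a * u)
  have h0 : D d * Q = W' * schrodinger d u + R' := by
    have h1 : D d * (coef d a * D d - coef d b)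
        = -(coef d a * schrodinger d u) + R' := by
      have h2 : D d * (coef d a * D d - coef d b)
        = (D d * coef d a) * D d - D d * coef d b := by noncomm_ring
      rw [h2, D_mul_coef, D_mul_coef, schrodinger]
      simp only [R', map_sub, map_mul]
      noncomm_ring
    rw [hQ, mul_add, h1]
    simp only [W']
    noncomm_ring
  have hW' : ∀ i, 2 * s + 1 ≤ i → coeff d W' i = 0 := by
    intro i hi
    obtain ⟨i, rfl⟩ : ∃ j, i = j + 1 := ⟨i - 1, by omega⟩
    rw [DiffOp.coeff_sub, coeff_D_mul_succ, hW _ (by omega), hW _ (by omega), coeff_coef,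
      if_neg (by omega), map_zero, add_zero, sub_zero]
  rw [det_subresMatrix (p := 2 * s + 1) (q := 2) (k := 0) (coeff_schrodinger_eq_zero u)
    (coeff_schrodinger_two u) rfl rfl two_pos (W := ![W', W])
    (R := ![R', coef d a * D d - coef d b])]
  · have hR0 : coeff d R' 0 = -(d b - a * u) := by rw [coeff_linear, if_pos rfl]
    have hR1 : coeff d R' 1 = d a - b := by
      rw [coeff_linear, if_neg one_ne_zero, if_pos rfl]
    rw [Matrix.det_fin_two]
    simp only [Matrix.of_apply, Matrix.cons_val_zero, Matrix.cons_val_one, Fin.val_zero,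
      Fin.val_one, coeff_linear, pow_succ, pow_mul]
    norm_num [hR0, hR1]
    ring
  · intro e
    fin_cases e
    · simpa using h0
    · simpa using hQ
  · intro e i hi
    fin_cases e
    · exact hW' i hi
    · exact hW i (by omega)
  · intro e i hi
    fin_cases e <;> simp only [Matrix.cons_val, R', Fin.zero_eta, Fin.mk_one] <;>
      rw [coeff_linear, if_neg (by omega), if_neg (by omega)]

end Subres

/-! ## Derivations on polynomials -/

section PolyDeriv

variable {E : Type*} [CommRing E] (d : Deriv E)

theorem polyDeriv_C (a : E) : polyDeriv d (C a) = C (d a) := by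
  simpa [polyDeriv] using DiffOp.polyDeriv_C_mul d a 1

theorem polyDeriv_X : polyDeriv d (X : E[X]) = 0 := by
  simpa [polyDeriv] using DiffOp.polyDeriv_X_mul d 1

theorem eval_polyDeriv {a : E} (ha : d a = 0) (p : E[X]) :
    (polyDeriv d p).eval a = d (p.eval a) := by
  induction p using Polynomial.induction_on with
  | C b => rw [polyDeriv_C, eval_C, eval_C]
  | add p q hp hq => rw [map_add, eval_add, eval_add, map_add, hp, hq]
  | monomial n b h =>
    rw [show (C b * X ^ (n + 1) : E[X]) = X * (C b * X ^ n) by ring, polyDeriv_X_mul, eval_mul,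
      eval_mul, h, Derivation.leibniz, eval_X, ha, smul_zero, add_zero, smul_eq_mul]

end PolyDeriv

/-! ## Non-vanishing of the subresultant on the spectral curve -/

variable {K : Type*} [Field K] {d : Deriv K} {u : K}

theorem evalAt_deriv (p : DiffPoly (constants d)) :
    evalAt d u (DiffPoly.deriv _ p) = d (evalAt d u p) := by
  have hc : ∀ a : constants d, d (a : K) = 0 := fun a => a.2
  induction p using MvPolynomial.induction_on with
  | C a =>
    rw [DiffPoly.deriv_C, map_zero, evalAt, MvPolynomial.aeval_C]
    exact (hc a).symm
  | add p q hp hq => simp only [map_add, hp, hq]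
  | mul_X p n hp =>
    rw [DiffPoly.deriv_mul, DiffPoly.deriv_X, map_add, map_mul, map_mul, hp, map_mul,
      Derivation.leibniz]
    simp only [evalAt, MvPolynomial.aeval_X, Function.iterate_succ_apply', smul_eq_mul]

theorem evalAt_u : evalAt d u (DiffPoly.u _) = u :=
  MvPolynomial.aeval_X _ 0

theorem two_mul_deriv_kdvSum_succ [CharZero K] (lam : constants d) (n : ℕ) :
    2 * d (kdvSum (evalAt d u).toRingHom (lam : K) (n + 1))
      = evalAt d u (kdv _ n) + lam • (2 * d (kdvSum (evalAt d u).toRingHom (lam : K) n)) := by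
  have hlam : d (lam : K) = 0 := lam.2
  have h2 : algebraMap (constants d) K 2 = 2 := map_ofNat _ 2
  rw [DiffPoly.kdv_eq, map_smul, evalAt_deriv, kdvSum, map_add, Derivation.leibniz, hlam,
    smul_zero, add_zero, Algebra.smul_def (2 : constants d), h2, smul_eq_mul]
  change _ = _ + (lam : K) * _
  simp only [AlgHom.toRingHom_eq_coe, RingHom.coe_coe]
  ring

theorem kdvSumExt_ne_zero [CharZero K] (hu : d u ≠ 0) {s : ℕ} (hs : IsKdVLevel d u s)
    (c : Fin s → constants d) (lam : constants d) :
    kdvSumExt (evalAt d u).toRingHom (lam : K) s c ≠ 0 := by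
  intro h0
  obtain ⟨t, rfl⟩ : ∃ t, s = t + 1 := ⟨s - 1, by have := hs.1.1; omega⟩
  -- The values `kdv_l(u)` with `l < s - 1`; everything in `2 Φ(λ₀)'` except `kdv_{s-1}(u)` lies in
  -- their span over the constants.
  set S : Submodule (constants d) K :=
    Submodule.span (constants d) (Set.range fun l : Fin t => evalAt d u (kdv _ l)) with hS
  set G : ℕ → K := kdvSum (evalAt d u).toRingHom (lam : K) with hG
  have hmem : ∀ n, n ≤ t → 2 * d (G n) ∈ S := by
    intro n
    induction n with
    | zero => simp [hG, kdvSum]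
    | succ n ih =>
      intro hn
      rw [hG, two_mul_deriv_kdvSum_succ]
      exact add_mem (Submodule.subset_span ⟨⟨n, hn⟩, rfl⟩) (S.smul_mem _ (ih (by omega)))
  have hx : evalAt d u (kdv _ t) + (lam • (2 * d (G t))
      + ∑ l : Fin (t + 1), c l.rev • (2 * d (G l))) = 0 := by
    have h1 : 2 * d (kdvSumExt (evalAt d u).toRingHom (lam : K) (t + 1) c) = 0 := by
      rw [h0, map_zero, mul_zero]
    have h2 : ∀ a : constants d, (evalAt d u).toRingHom (MvPolynomial.C a) = (a : K) :=
      fun a => MvPolynomial.aeval_C _ a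
    have h3 : ∀ a : constants d, d (a : K) = 0 := fun a => a.2
    rw [← add_assoc, ← two_mul_deriv_kdvSum_succ, ← h1, kdvSumExt, map_add, map_sum, mul_add,
      Finset.mul_sum]
    congr 1
    refine Finset.sum_congr rfl fun l _ => ?_
    rw [h2, Derivation.leibniz, h3, smul_zero, add_zero, smul_eq_mul, mul_left_comm]
    rfl
  obtain ⟨b, hb⟩ := (Submodule.mem_span_range_iff_exists_fun (constants d)).1
    (add_mem (S.smul_mem lam (hmem t le_rfl))
      (sum_mem fun (l : Fin (t + 1)) _ => S.smul_mem (c l.rev) (hmem l (by omega))))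
  have hz : evalAt d u (kdvExt t fun l => b l.rev) = 0 := by
    rw [kdvExt, map_add, map_sum, ← hx, ← hb]
    simp only [map_smul, Fin.rev_rev]
  -- Levels start at 1, so `s = 1` is separate: there the relation reads `kdv_0(u) = u' = 0`.
  rcases t with _ | t
  · apply hu
    simpa [kdvExt, kdv, evalAt_deriv, evalAt_u] using hz
  · have := hs.2 ⟨Nat.succ_pos t, _, hz⟩
    omega

/-! ## The subresultants of the Lax pair -/

section LaxPair

variable (d u) {s : ℕ} (c : Fin s → constants d)

/-- The polynomial in `λ` that is the leading coefficient of the first subresultant. -/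
noncomputable def laxPoly : K[X] :=
  kdvSumExt ((C : K →+* K[X]).comp (evalAt d u).toRingHom) X s c

theorem derivLM_C_C (x : K) : ((C : K[X] →+* K[X][X]).comp C) (d x)
    = derivLM d (((C : K[X] →+* K[X][X]).comp C) x) := by
  simp only [RingHom.comp_apply, polyDeriv_C]

theorem opLlam_eq : opLlam d u = schrodinger (derivLM d) (C (C u) - C X) := by
  rw [opLlam, map_schrodinger (derivLM_C_C d), schrodinger_sub_coef, RingHom.comp_apply]

theorem order_opLlam : order (derivLM d) (opLlam d u) = 2 := by
  rw [opLlam_eq]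
  refine order_eq (coeff_schrodinger_eq_zero _) ?_
  rw [coeff_schrodinger_two]
  exact neg_ne_zero.2 one_ne_zero

theorem order_opAmu : order (derivLM d) (opAmu d u s c) = 2 * s + 1 := by
  refine order_eq (fun i hi => ?_) ?_
  · rw [opAmu, opA, DiffOp.coeff_sub, DiffOp.coeff_map, DiffOp.coeff_map,
      (coeff_kdvOpExt s c).1 i hi, coeff_coef, if_neg (by omega)]
    simp
  · rw [opAmu, opA, DiffOp.coeff_sub, DiffOp.coeff_map, DiffOp.coeff_map,
      (coeff_kdvOpExt s c).2, coeff_coef, if_neg (by omega)]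
    simp

theorem exists_opAmu_eq : ∃ W : DiffOp (derivLM d),
    (∀ i, 2 * s ≤ i → coeff (derivLM d) W i = 0) ∧
    opAmu d u s c = W * schrodinger (derivLM d) (C (C u) - C X)
      + (coef (derivLM d) (C (laxPoly d u c)) * D (derivLM d)
        - coef (derivLM d) (C (C (1 / 2) * polyDeriv d (laxPoly d u c)) + X)) := by
  let f : DiffPoly (constants d) →+* K[X][X] :=
    ((C : K[X] →+* K[X][X]).comp C).comp (evalAt d u).toRingHom
  have hf : ∀ p, f (DiffPoly.deriv _ p) = derivLM d (f p) := fun p => by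
    change C (C (evalAt d u _)) = derivLM d (C (C (evalAt d u p)))
    rw [evalAt_deriv, polyDeriv_C, polyDeriv_C]
  have hu : f (DiffPoly.u _) = C (C u) := congrArg (fun x : K => (C (C x) : K[X][X])) evalAt_u
  have hh : f (MvPolynomial.C (1 / 2)) = C (C (1 / 2)) := by
    have : evalAt d u (MvPolynomial.C (1 / 2)) = 1 / 2 := by
      rw [evalAt, MvPolynomial.aeval_C, map_div₀, map_one, map_ofNat]
    exact congrArg (fun x : K => (C (C x) : K[X][X])) this
  have hlam : derivLM d (C X) = 0 := by rw [polyDeriv_C, polyDeriv_X, map_zero]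
  obtain ⟨W, hW, h⟩ := exists_kdvOpExt_eq hf hlam s c
  have hΦ : kdvSumExt f (C X) s c = C (laxPoly d u c) := by
    rw [laxPoly, map_kdvSumExt, ← RingHom.comp_assoc]
  refine ⟨W, hW, ?_⟩
  rw [hu, hh, hΦ, schrodinger_sub_coef, polyDeriv_C, ← map_mul] at h
  rw [opAmu, opA, DiffOp.map_map, h, map_add (coef (derivLM d))]
  abel

theorem subresPhi₁_eq : subresPhi₁ d u s c
    = -X - C (C (1 / 2) * polyDeriv d (laxPoly d u c)) := by
  obtain ⟨W, hW, h⟩ := exists_opAmu_eq d u c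
  rw [subresPhi₁, subresCoeff, order_opLlam, order_opAmu, opLlam_eq, det_subresMatrix_one hW h,
    coeff_linear, if_pos rfl]
  ring

theorem subresPhi₂_eq : subresPhi₂ d u s c = C (laxPoly d u c) := by
  obtain ⟨W, hW, h⟩ := exists_opAmu_eq d u c
  rw [subresPhi₂, subresCoeff, order_opLlam, order_opAmu, opLlam_eq, det_subresMatrix_one hW h,
    coeff_linear, if_neg one_ne_zero, if_pos rfl]

theorem eval_laxPoly (lam : K) : (laxPoly d u c).eval lam
    = kdvSumExt (evalAt d u).toRingHom lam s c := by
  have h : (evalRingHom lam).comp ((C : K →+* K[X]).comp (evalAt d u).toRingHom)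
      = (evalAt d u).toRingHom := by
    ext <;> simp
  rw [laxPoly, ← coe_evalRingHom, map_kdvSumExt, h, coe_evalRingHom, eval_X]

theorem deriv_half : d (1 / 2) = 0 := by
  have h : d (2 : K) = 0 := by simpa using d.map_natCast 2
  rw [one_div, Derivation.leibniz_inv, h, smul_zero]

variable {d u c} in
-- Evaluation at a constant `lam` commutes with differentiation; `μ` has already been differentiated
-- to zero as an indeterminate.
theorem evalEval_spectralPoly {lam mu : K} (hlam : d lam = 0) :
    (spectralPoly d u s c).evalEval lam mu =
      (d ((laxPoly d u c).eval lam) - (1 / 2 * d ((laxPoly d u c).eval lam) + mu))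
          * (1 / 2 * d ((laxPoly d u c).eval lam) + mu)
        + (laxPoly d u c).eval lam * ((laxPoly d u c).eval lam * (u - lam)
          - 1 / 2 * d (d ((laxPoly d u c).eval lam))) := by
  obtain ⟨W, hW, h⟩ := exists_opAmu_eq d u c
  rw [spectralPoly, diffRes, subresCoeff, order_opLlam, order_opAmu, opLlam_eq,
    det_subresMatrix_zero hW h, map_add (derivLM d), polyDeriv_X, polyDeriv_C, polyDeriv_C]
  simp only [evalEval_add, evalEval_sub, evalEval_mul, evalEval_C, evalEval_X, eval_mul, eval_C,
    eval_X, eval_polyDeriv d hlam, Derivation.leibniz, deriv_half, smul_eq_mul, mul_zero,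
    add_zero, polyDeriv_C, map_zero]

end LaxPair

/-- With `b = g φ`, the resultant expression equals `-g² (φ' + φ² - w)`, and `g²` cancels. -/
theorem riccati_of_resultant_eq_zero {g b w φ : K} (hg : g ≠ 0) (hφ : g * φ = b)
    (hb : d b = 1 / 2 * d (d g))
    (h : (d g - b) * b + g * (g * w - 1 / 2 * d (d g)) = 0) : d φ + φ ^ 2 = w := by
  have h1 : g * d φ + φ * d g = 1 / 2 * d (d g) := by
    rw [← hb, ← hφ, Derivation.leibniz, smul_eq_mul, smul_eq_mul]
  apply mul_left_cancel₀ (pow_ne_zero 2 hg)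
  linear_combination g * h1 + (g * φ + b - d g) * hφ - h

end KdV

theorem mainTheorem4 {K : Type*} [Field K] [CharZero K] (d : Derivation ℤ K K)
    [IsAlgClosed (KdV.constants d)] (u : K) (hu : d u ≠ 0) (s : ℕ) (hs : KdV.IsKdVLevel d u s)
    (c : Fin s → KdV.constants d) (hc : c ∈ KdV.kdvConstants d u s) :
    ∃ α φ₂ : K[X],
      KdV.subresPhi₁ d u s c = -X - C α ∧
      KdV.subresPhi₂ d u s c = C φ₂ ∧
      ∀ lam₀ mu₀ : KdV.constants d, (lam₀, mu₀) ∈ KdV.spectralCurve d u s c →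
        φ₂.eval (lam₀ : K) ≠ 0 ∧
        ∃ φ₀ : K,
          φ₀ = -(KdV.subresPhi₁ d u s c).evalEval (lam₀ : K) (mu₀ : K) /
              (KdV.subresPhi₂ d u s c).evalEval (lam₀ : K) (mu₀ : K) ∧
          φ₀ = ((mu₀ : K) + α.eval (lam₀ : K)) / φ₂.eval (lam₀ : K) ∧
          KdV.DiffOp.IsRightFactor (KdV.DiffOp.D d - KdV.DiffOp.coef d φ₀)
            (KdV.DiffOp.schrodinger d u - KdV.DiffOp.coef d (lam₀ : K)) ∧
          KdV.DiffOp.IsRightFactor (KdV.DiffOp.D d - KdV.DiffOp.coef d φ₀)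
            (KdV.opA d u s c - KdV.DiffOp.coef d (mu₀ : K)) ∧
          KdV.DiffOp.schrodinger d u - KdV.DiffOp.coef d (lam₀ : K) =
            (-(KdV.DiffOp.D d) - KdV.DiffOp.coef d φ₀) * (KdV.DiffOp.D d - KdV.DiffOp.coef d φ₀) := by
  refine ⟨C (1 / 2) * KdV.polyDeriv d (KdV.laxPoly d u c), KdV.laxPoly d u c,
    KdV.subresPhi₁_eq d u c, KdV.subresPhi₂_eq d u c, fun lam₀ mu₀ hP => ?_⟩
  have hlam : d (lam₀ : K) = 0 := lam₀.2
  have hmu : d (mu₀ : K) = 0 := mu₀.2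
  have hf : (KdV.spectralPoly d u s c).evalEval (lam₀ : K) (mu₀ : K) = 0 := hP
  rw [KdV.evalEval_spectralPoly hlam] at hf
  have hg := KdV.kdvSumExt_ne_zero hu hs c lam₀
  obtain ⟨W, -, hW⟩ := KdV.exists_kdvOpExt_eq (d := d) (f := (KdV.evalAt d u).toRingHom)
    KdV.evalAt_deriv hlam s c
  have hhalf : (KdV.evalAt d u).toRingHom (MvPolynomial.C (1 / 2)) = 1 / 2 := by
    change KdV.evalAt d u _ = _
    rw [KdV.evalAt, MvPolynomial.aeval_C, map_div₀, map_one, map_ofNat]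
  have hU : (KdV.evalAt d u).toRingHom (KdV.DiffPoly.u _) = u := KdV.evalAt_u
  rw [hhalf, hU] at hW
  rw [← KdV.eval_laxPoly] at hg hW
  have hα : (C (1 / 2) * KdV.polyDeriv d (KdV.laxPoly d u c)).eval (lam₀ : K)
      = 1 / 2 * d ((KdV.laxPoly d u c).eval (lam₀ : K)) := by
    rw [eval_mul, eval_C, KdV.eval_polyDeriv d hlam]
  set g : K := (KdV.laxPoly d u c).eval (lam₀ : K) with hgdef
  set φ : K := ((mu₀ : K) + 1 / 2 * d g) / g with hφdef
  have hφ : g * φ = 1 / 2 * d g + mu₀ := by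
    rw [hφdef, mul_div_cancel₀ _ hg, add_comm]
  have hb : d (1 / 2 * d g + mu₀) = 1 / 2 * d (d g) := by
    rw [map_add, hmu, Derivation.leibniz, KdV.deriv_half, smul_zero, add_zero, add_zero,
      smul_eq_mul]
  have hfac := KdV.DiffOp.schrodinger_factor
    (KdV.riccati_of_resultant_eq_zero hg hφ hb hf)
  rw [← KdV.DiffOp.schrodinger_sub_coef] at hfac
  -- The quotient of `A - μ₀` by `∂ - φ` combines `W (L - λ₀) = W (-∂ - φ)(∂ - φ)` with the
  -- remainder `g (∂ - φ)`.
  refine ⟨hg, φ, ?_, ?_, ⟨_, hfac⟩, ⟨W * (-(KdV.DiffOp.D d) - KdV.DiffOp.coef d φ)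
    + KdV.DiffOp.coef d g, ?_⟩, hfac⟩
  · rw [KdV.subresPhi₁_eq, KdV.subresPhi₂_eq, evalEval_C, evalEval_sub, evalEval_C, hα,
      evalEval_neg, evalEval_X, hφdef]
    ring
  · rw [hα]
  · have h1 : KdV.DiffOp.coef d g * KdV.DiffOp.coef d φ
        = KdV.DiffOp.coef d (1 / 2 * d g) + KdV.DiffOp.coef d mu₀ := by
      rw [← map_mul, hφ, map_add]
    rw [KdV.opA, hW, hfac, add_mul, mul_sub (KdV.DiffOp.coef d g), h1, mul_assoc]
    abel
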